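/- Let $d\ge 2$ be an integer and let $p\ge 2$ be a real number. Let $W^{1,p}_A(\mathbb{R}^d)$ denote the set of real-valued functions $u\in W^{1,p}(\mathbb{R}^d)$ (that is, $u\in L^p(\mathbb{R}^d)$ with weak gradient $\nabla u\in L^p(\mathbb{R}^d;\mathbb{R}^d)$) that are antisymmetric: for all $1\le i\neq j\le d$ and almost every $x\in\mathbb{R}^d$, $$u(x_1,\dots,x_i,\dots,x_j,\dots,x_d)=-u(x_1,\dots,x_j,\dots,x_i,\dots,x_d).$$ Then for every $u\in W^{1,p}_A(\mathbb{R}^d)$ both integrals below are finite and $$\int_{\mathbb{R}^d}|\nabla u(x)|^p\,dx\;\ge\; C_H(d,p)\int_{\mathbb{R}^d}\frac{|u(x)|^p}{|x|^p}\,dx,$$ where $|\cdot|$ is the Euclidean norm and $$C_H(d,p)=\left(\frac{2(p-2)d(d-1)}{p^2}+\left(\frac{d^2-p}{p}\right)^2\right)^{p/2}.$$ -/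

import Mathlib

open MeasureTheory
open scoped ContDiff

namespace HardyAntisym

/-- The vector field `g` is a weak (distributional) gradient of `u` on `ℝ^d`: both are locally
integrable, and `∫ u ∂ᵢφ = - ∫ gᵢ φ` for all test functions `φ ∈ C_c^∞(ℝ^d)` and all `i`. -/
def IsWeakGradient {d : ℕ} (u : EuclideanSpace ℝ (Fin d) → ℝ)
    (g : EuclideanSpace ℝ (Fin d) → EuclideanSpace ℝ (Fin d)) : Prop :=
  LocallyIntegrable u volume ∧ LocallyIntegrable g volume ∧
    ∀ φ : EuclideanSpace ℝ (Fin d) → ℝ, ContDiff ℝ ∞ φ → HasCompactSupport φ →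
      ∀ i : Fin d,
        ∫ x, u x * fderiv ℝ φ x (EuclideanSpace.single i 1) = - ∫ x, g x i * φ x

/-- Membership in the Sobolev space `W^{1,p}(ℝ^d)` of real-valued functions: `u ∈ L^p`, and `u`
has a weak gradient in `L^p`. -/
def MemW1p {d : ℕ} (p : ℝ) (u : EuclideanSpace ℝ (Fin d) → ℝ) : Prop :=
  MemLp u (ENNReal.ofReal p) volume ∧
    ∃ g : EuclideanSpace ℝ (Fin d) → EuclideanSpace ℝ (Fin d),
      IsWeakGradient u g ∧ MemLp g (ENNReal.ofReal p) volume

/-- The point obtained from `x` by interchanging its coordinates `i` and `j`. -/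
def swapCoord {d : ℕ} (i j : Fin d) (x : EuclideanSpace ℝ (Fin d)) :
    EuclideanSpace ℝ (Fin d) :=
  WithLp.toLp 2 fun k => x (Equiv.swap i j k)

/-- `u` is antisymmetric: interchanging two different coordinates changes the sign. As elements of
Sobolev spaces are functions up to null sets, the identity is required almost everywhere. -/
def IsAntisymmetric {d : ℕ} (u : EuclideanSpace ℝ (Fin d) → ℝ) : Prop :=
  ∀ i j : Fin d, i ≠ j → ∀ᵐ x ∂(volume : Measure (EuclideanSpace ℝ (Fin d))),
    u (swapCoord i j x) = - u x

/-- Membership in the antisymmetric Sobolev space `W^{1,p}_A(ℝ^d)`. -/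
def MemW1pA {d : ℕ} (p : ℝ) (u : EuclideanSpace ℝ (Fin d) → ℝ) : Prop :=
  MemW1p p u ∧ IsAntisymmetric u

/-- The constant `C_H(d,p)`. -/
noncomputable def hardyConst (d : ℕ) (p : ℝ) : ℝ :=
  (2 * (p - 2) * (d : ℝ) * ((d : ℝ) - 1) / p ^ 2 + (((d : ℝ) ^ 2 - p) / p) ^ 2) ^ (p / 2)

end HardyAntisym

/-! The Vandermonde product V is harmonic and homogeneous of degree d(d-1)/2. The ground state is
V|x|^(-β), with logarithmic gradient G. Off the walls x_i = x_j, harmonicity and Euler's identity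
give div(|x|^(-(p-2)) G) + |x|^(-(p-2)) |G|² = -c |x|^(-p), and β = (d²-p)/2 makes c largest, namely
c = p²κ/4 with κ = `hardyBase d p` (`sum_groundFieldDeriv_add`).

Let a = (|v|-ε)₊, with v smooth enough and zero on the walls. Young's inequality and a completed
square bound |∇v|^p from below by κ^((p-2)/2) times an expression affine in |∇v|
(`rpow_ge_of_young`). By Cauchy-Schwarz it dominates one containing ∇(a^p)·G. Integrating by parts
and inserting the equation leaves the factor (2/p)(p²κ/4) - (p-2)κ/2 = κ, hence the constant κ^(p/2)
(`hardy_truncation`).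

Antisymmetry is what makes the singular field G admissible: mollification by a radial kernel
preserves it, so the approximations vanish on the walls, and {|v| ≥ ε} is a compact set away from
them. Mollification does not increase the L^p norm of the gradient, the cutoff error tends to zero,
and Fatou's lemma handles the limit of approximation and truncation together (`lintegral_hardy_le`).
-/

namespace HardyAntisym

/-! ### The Vandermonde product and the ground state equation -/

/-- The logarithmic gradient of the Vandermonde product. The terms `j = i` vanish, as `0⁻¹ = 0`. -/
noncomputable def vandermondeLogGrad {d : ℕ} (x : EuclideanSpace ℝ (Fin d)) (i : Fin d) : ℝ :=
  ∑ j, (x i - x j)⁻¹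

/-- Harmonicity of the Vandermonde product, in terms of its logarithmic gradient. -/
lemma sum_vandermondeLogGrad_sq {d : ℕ} {x : EuclideanSpace ℝ (Fin d)}
    (hx : ∀ i j, i ≠ j → x i ≠ x j) :
    ∑ i, vandermondeLogGrad x i ^ 2 = ∑ i, ∑ j, ((x i - x j)⁻¹) ^ 2 := by
  -- The off-diagonal part of the expanded square. It sums to zero by 1/((a-b)(a-c)) +
  -- 1/((b-c)(b-a)) + 1/((c-a)(c-b)) = 0; with coinciding indices every term is already zero, as 0⁻¹
  -- = 0.
  let T : Fin d → Fin d → Fin d → ℝ := fun i j k =>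
    if j = k then 0 else (x i - x j)⁻¹ * (x i - x k)⁻¹
  have hcyc : ∀ i j k, T i j k + T j k i + T k i j = 0 := by
    intro i j k
    by_cases hij : i = j
    · subst hij; simp [T]
    by_cases hjk : j = k
    · subst hjk; simp [T]
    by_cases hik : i = k
    · subst hik; simp [T]
    have h1 := sub_ne_zero.2 (hx i j hij)
    have h2 := sub_ne_zero.2 (hx j k hjk)
    have h3 := sub_ne_zero.2 (hx i k hik)
    have h1' := sub_ne_zero.2 (hx j i (Ne.symm hij))
    have h2' := sub_ne_zero.2 (hx k j (Ne.symm hjk))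
    have h3' := sub_ne_zero.2 (hx k i (Ne.symm hik))
    simp only [T, hij, hjk, Ne.symm hik, if_false]
    field_simp
    ring
  have e1 : ∑ i, ∑ j, ∑ k, T j k i = ∑ i, ∑ j, ∑ k, T i j k := by
    rw [Finset.sum_comm]
    refine Finset.sum_congr rfl fun j _ => ?_
    rw [Finset.sum_comm]
  have e2 : ∑ i, ∑ j, ∑ k, T k i j = ∑ i, ∑ j, ∑ k, T i j k := by
    calc _ = ∑ i, ∑ k, ∑ j, T k i j := Finset.sum_congr rfl fun i _ => Finset.sum_comm
      _ = _ := Finset.sum_comm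
  have hT : ∑ i, ∑ j, ∑ k, T i j k = 0 := by
    have h : ∑ i, ∑ j, ∑ k, (T i j k + T j k i + T k i j) = 0 := by simp [hcyc]
    simp only [Finset.sum_add_distrib] at h
    linarith
  have hsq : ∀ i, vandermondeLogGrad x i ^ 2
      = ∑ j, ∑ k, T i j k + ∑ j, ((x i - x j)⁻¹) ^ 2 := by
    intro i
    rw [vandermondeLogGrad, sq, Finset.sum_mul_sum, ← Finset.sum_add_distrib]
    refine Finset.sum_congr rfl fun j _ => ?_
    have : ((x i - x j)⁻¹) ^ 2 = ∑ k, if j = k then (x i - x j)⁻¹ * (x i - x k)⁻¹ else 0 := by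
      simp [sq]
    rw [this, ← Finset.sum_add_distrib]
    refine Finset.sum_congr rfl fun k _ => ?_
    by_cases h : j = k <;> simp [T, h]
  simp only [hsq, Finset.sum_add_distrib, hT, zero_add]

/-- Euler's identity for the homogeneous Vandermonde product. -/
lemma sum_mul_vandermondeLogGrad {d : ℕ} {x : EuclideanSpace ℝ (Fin d)}
    (hx : ∀ i j, i ≠ j → x i ≠ x j) :
    ∑ i, x i * vandermondeLogGrad x i = (d : ℝ) * (d - 1) / 2 := by
  have h1 : ∑ i, x i * vandermondeLogGrad x i = ∑ i, ∑ j, x i * (x i - x j)⁻¹ := by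
    simp only [vandermondeLogGrad, Finset.mul_sum]
  -- Renaming i ↔ j and averaging: each ordered pair i ≠ j then contributes (x_i - x_j)/(x_i - x_j)
  -- = 1 to twice the sum.
  have h2 : ∑ i, x i * vandermondeLogGrad x i = ∑ i, ∑ j, -(x j * (x i - x j)⁻¹) := by
    rw [h1, Finset.sum_comm]
    refine Finset.sum_congr rfl fun i _ => Finset.sum_congr rfl fun j _ => ?_
    rw [← neg_sub (x i) (x j), inv_neg]; ring
  have h3 : ∑ i, ∑ j, (x i * (x i - x j)⁻¹ + -(x j * (x i - x j)⁻¹)) = (d : ℝ) * (d - 1) := by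
    have : ∀ i j, x i * (x i - x j)⁻¹ + -(x j * (x i - x j)⁻¹) = 1 - if i = j then 1 else 0 := by
      intro i j
      by_cases h : i = j
      · subst h; simp
      · have := sub_ne_zero.2 (hx i j h)
        simp only [h, if_false]
        field_simp
        ring
    simp [this, mul_sub]
  simp only [Finset.sum_add_distrib] at h3
  linarith

/-- The logarithmic gradient of the ground state, i.e. of the Vandermonde product times
`‖x‖ ^ (-β)`. -/
noncomputable def groundLogGrad {d : ℕ} (β : ℝ) (x : EuclideanSpace ℝ (Fin d)) (i : Fin d) : ℝ :=
  vandermondeLogGrad x i - β * x i / ‖x‖ ^ 2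

/-- The `i`-th partial derivative of `(‖x‖ ^ 2) ^ q * groundLogGrad β x i`. -/
noncomputable def groundFieldDeriv {d : ℕ} (q β : ℝ) (x : EuclideanSpace ℝ (Fin d)) (i : Fin d) :
    ℝ :=
  2 * x i * q * (‖x‖ ^ 2) ^ (q - 1) * groundLogGrad β x i +
    (‖x‖ ^ 2) ^ q * (-(∑ j, ((x i - x j)⁻¹) ^ 2) -
      (β * ‖x‖ ^ 2 - β * x i * (2 * x i)) / (‖x‖ ^ 2) ^ 2)

lemma hasLineDerivAt_groundField {d : ℕ} (q β : ℝ) {x : EuclideanSpace ℝ (Fin d)}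
    (hx : ∀ i j, i ≠ j → x i ≠ x j) (hx0 : x ≠ 0) (i : Fin d) :
    HasLineDerivAt ℝ (fun y => (‖y‖ ^ 2) ^ q * groundLogGrad β y i) (groundFieldDeriv q β x i) x
      (EuclideanSpace.single i 1) := by
  unfold HasLineDerivAt
  have hcoord : ∀ k, HasDerivAt (fun t : ℝ => (x + t • EuclideanSpace.single i (1 : ℝ)) k)
      (if k = i then 1 else 0) 0 := by
    intro k
    have h := ((hasDerivAt_id (0 : ℝ)).mul_const
      ((EuclideanSpace.single i (1 : ℝ) : EuclideanSpace ℝ (Fin d)) k)).const_add (x k)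
    exact h.congr_deriv (by simp)
  have hnorm : HasDerivAt (fun t : ℝ => ‖x + t • EuclideanSpace.single i (1 : ℝ)‖ ^ 2)
      (2 * x i) 0 := by
    have h : HasDerivAt (fun t : ℝ => ∑ k, (x + t • EuclideanSpace.single i (1 : ℝ)) k ^ 2)
        (∑ k, 2 * x k * (if k = i then 1 else 0)) 0 := by
      refine HasDerivAt.fun_sum fun k _ => ?_
      have h := (hcoord k).pow 2
      exact h.congr_deriv (by simp)
    simpa [EuclideanSpace.norm_sq_eq] using h
  have hA : HasDerivAt
      (fun t : ℝ => vandermondeLogGrad (x + t • EuclideanSpace.single i (1 : ℝ)) i)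
      (-(∑ j, ((x i - x j)⁻¹) ^ 2)) 0 := by
    rw [← Finset.sum_neg_distrib]
    refine HasDerivAt.fun_sum fun j _ => ?_
    by_cases h : i = j
    · subst h
      simpa using hasDerivAt_const (0 : ℝ) (0 : ℝ)
    · have hne := sub_ne_zero.2 (hx i j h)
      have h := ((hcoord i).sub (hcoord j)).inv (by simpa using hne)
      refine h.congr_deriv ?_
      have hji : j ≠ i := fun e => hne (by simp [e])
      simp [hji, neg_div]
  have hxi : HasDerivAt (fun t : ℝ => β * (x + t • EuclideanSpace.single i (1 : ℝ)) i) β 0 := by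
    simpa using (hcoord i).const_mul β
  have hdiv := hxi.div hnorm (by simpa using hx0)
  have h := (hnorm.rpow_const (p := q) (Or.inl (by simpa using hx0))).mul (hA.sub hdiv)
  refine h.congr_deriv ?_
  simp [groundFieldDeriv, groundLogGrad]

/-- The ground state equation in divergence form. -/
lemma sum_groundFieldDeriv_add {d : ℕ} (q β : ℝ) {x : EuclideanSpace ℝ (Fin d)}
    (hx : ∀ i j, i ≠ j → x i ≠ x j) (hx0 : x ≠ 0) :
    ∑ i, groundFieldDeriv q β x i + (‖x‖ ^ 2) ^ q * ∑ i, groundLogGrad β x i ^ 2 =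
      (β ^ 2 - β * ((d : ℝ) ^ 2 - 2 + 2 * q) + q * d * (d - 1)) * (‖x‖ ^ 2) ^ (q - 1) := by
  have hs : 0 < ‖x‖ ^ 2 := by positivity
  have h1 := sum_vandermondeLogGrad_sq hx
  have h2 := sum_mul_vandermondeLogGrad hx
  have h3 : ∑ i, x i ^ 2 = ‖x‖ ^ 2 := by simp [EuclideanSpace.norm_sq_eq]
  set s := ‖x‖ ^ 2 with hsdef
  have hq : s ^ q = s ^ (q - 1) * s := by
    rw [← Real.rpow_add_one hs.ne']; congr 1; ring
  have e1 : ∑ i, groundLogGrad β x i ^ 2 =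
      ∑ i, vandermondeLogGrad x i ^ 2 - 2 * β / s * ∑ i, x i * vandermondeLogGrad x i
        + β ^ 2 / s ^ 2 * ∑ i, x i ^ 2 := by
    simp only [Finset.mul_sum, ← Finset.sum_sub_distrib, ← Finset.sum_add_distrib]
    refine Finset.sum_congr rfl fun i _ => ?_
    simp only [groundLogGrad, ← hsdef]
    field_simp
    ring
  have e2 : ∑ i, groundFieldDeriv q β x i =
      2 * q * s ^ (q - 1) * ∑ i, x i * vandermondeLogGrad x i
      - 2 * q * s ^ (q - 1) * β / s * ∑ i, x i ^ 2
      - s ^ q * ∑ i, ∑ j, ((x i - x j)⁻¹) ^ 2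
      - ∑ _i : Fin d, s ^ q * β / s + 2 * β * s ^ q / s ^ 2 * ∑ i, x i ^ 2 := by
    simp only [Finset.mul_sum (f := fun i => x i * vandermondeLogGrad x i),
      Finset.mul_sum (f := fun i => x i ^ 2),
      Finset.mul_sum (f := fun i => ∑ j, ((x i - x j)⁻¹) ^ 2),
      ← Finset.sum_sub_distrib, ← Finset.sum_add_distrib]
    refine Finset.sum_congr rfl fun i _ => ?_
    simp only [groundFieldDeriv, groundLogGrad, ← hsdef]
    field_simp
    ring
  rw [e1, e2, h1, h2, h3, hq]
  simp only [Finset.sum_const, Finset.card_univ, Fintype.card_fin, nsmul_eq_mul]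
  field_simp
  ring

/-! ### The pointwise inequality and the truncated power -/

/-- The pointwise inequality behind the Hardy inequality: the `p`-th power of the gradient is
bounded from below by an expression which is affine in the gradient. -/
lemma rpow_ge_of_young {p a r T g κ : ℝ} (hp : 2 ≤ p) (ha : 0 ≤ a) (hr : 0 < r) (hT : 0 ≤ T)
    (hκ : 0 < κ) :
    κ ^ ((p - 2) / 2) * (2 * a ^ (p - 1) * (r ^ 2) ^ (-(p - 2) / 2) * (T * g)
      - 2 / p * (a ^ p * (r ^ 2) ^ (-(p - 2) / 2) * g ^ 2)
      - (p - 2) / 2 * κ * (a ^ p * (r ^ 2) ^ (-(p - 2) / 2 - 1))) ≤ T ^ p := by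
  have hp0 : 0 < p := by linarith
  have ha1 : a ^ (p - 1) = a ^ (p - 2) * a := by
    rw [← Real.rpow_add_one' ha (by linarith)]; congr 1; ring
  have ha2 : a ^ p = a ^ (p - 2) * a ^ 2 := by
    rw [← Real.rpow_natCast, ← Real.rpow_add' ha (by norm_num; linarith)]; congr 1; norm_num
  have hr1 : (r ^ 2) ^ (-(p - 2) / 2) = (r ^ (p - 2))⁻¹ := by
    rw [← Real.rpow_natCast, ← Real.rpow_mul hr.le, ← Real.rpow_neg hr.le]; congr 1
    push_cast; ring
  have hr2 : (r ^ 2) ^ (-(p - 2) / 2 - 1) = (r ^ p)⁻¹ := by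
    rw [← Real.rpow_natCast, ← Real.rpow_mul hr.le, ← Real.rpow_neg hr.le]; congr 1
    push_cast; ring
  -- The value of `T` at which the Young inequality below is an equality.
  set b := Real.sqrt κ * a / r with hb
  have hb0 : 0 ≤ b := by positivity
  have hpow : ∀ y : ℝ, b ^ y = κ ^ (y / 2) * a ^ y * (r ^ y)⁻¹ := by
    intro y
    rw [hb, Real.div_rpow (by positivity) hr.le, Real.mul_rpow (by positivity) ha,
      Real.sqrt_eq_rpow, ← Real.rpow_mul hκ.le, div_eq_mul_inv]
    rw [one_div_mul_eq_div]
  have hκ1 : κ ^ (p / 2) = κ ^ ((p - 2) / 2) * κ := by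
    rw [← Real.rpow_add_one hκ.ne']; congr 1; ring
  have hyoung : p / 2 * (b ^ (p - 2) * T ^ 2) ≤ T ^ p + (p - 2) / 2 * b ^ p := by
    have h := Real.geom_mean_le_arith_mean2_weighted (w₁ := (p - 2) / p) (w₂ := 2 / p)
      (p₁ := b ^ p) (p₂ := T ^ p) (div_nonneg (by linarith) hp0.le) (by positivity)
      (by positivity) (by positivity) (by field_simp; ring)
    rw [← Real.rpow_mul hb0, ← Real.rpow_mul hT, mul_div_cancel₀ _ hp0.ne',
      mul_div_cancel₀ _ hp0.ne', Real.rpow_two] at h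
    calc p / 2 * (b ^ (p - 2) * T ^ 2) ≤ p / 2 * ((p - 2) / p * b ^ p + 2 / p * T ^ p) := by gcongr
      _ = _ := by field_simp; ring
  have hbp := hpow p
  have hbp2 := hpow (p - 2)
  rw [hκ1] at hbp
  have hC : 0 ≤ κ ^ ((p - 2) / 2) * a ^ (p - 2) * (r ^ (p - 2))⁻¹ := by positivity
  -- Completing the square replaces T² by an expression affine in T; equality holds at T = (2/p) a
  -- g.
  have hsq : 0 ≤ p / 2 * (T - 2 / p * (a * g)) ^ 2 := by positivity
  have hsq' : 2 * a * (T * g) - 2 / p * (a ^ 2 * g ^ 2) ≤ p / 2 * T ^ 2 := by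
    have : p / 2 * (T - 2 / p * (a * g)) ^ 2
      = p / 2 * T ^ 2 - (2 * a * (T * g) - 2 / p * (a ^ 2 * g ^ 2)) := by field_simp; ring
    linarith
  have hmain := mul_le_mul_of_nonneg_left hsq' hC
  rw [hr1, hr2, ha1]
  rw [hbp, hbp2] at hyoung
  nth_rw 1 [ha2]
  linarith

lemma hasDerivAt_max_zero_rpow {p : ℝ} (hp : 1 < p) (t : ℝ) :
    HasDerivAt (fun s : ℝ => max s 0 ^ p) (p * max t 0 ^ (p - 1)) t := by
  rcases lt_trichotomy t 0 with ht | rfl | ht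
  · have h : (fun s : ℝ => max s 0 ^ p) =ᶠ[nhds t] fun _ => 0 := by
      filter_upwards [Iio_mem_nhds ht] with s hs
      rw [max_eq_right (le_of_lt hs), Real.zero_rpow (by linarith)]
    rw [max_eq_right ht.le, Real.zero_rpow (by linarith), mul_zero]
    exact (hasDerivAt_const t (0 : ℝ)).congr_of_eventuallyEq h
  -- At the corner, the function is dominated by |s|^p, which is o(s) since p > 1.
  · have h := hasDerivAt_abs_rpow 0 hp
    rw [hasDerivAt_iff_isLittleO] at h ⊢
    have h0 : (0 : ℝ) ^ p = 0 := Real.zero_rpow (by linarith)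
    have h1 : (0 : ℝ) ^ (p - 1) = 0 := Real.zero_rpow (by linarith)
    simp only [abs_zero, h0, mul_zero, smul_zero, sub_zero, max_self, h1] at h ⊢
    refine Asymptotics.IsBigO.trans_isLittleO (Asymptotics.IsBigO.of_bound 1 ?_) h
    refine Filter.Eventually.of_forall fun s => ?_
    rw [one_mul, Real.norm_of_nonneg (by positivity), Real.norm_of_nonneg (by positivity)]
    exact Real.rpow_le_rpow (le_max_right _ _) (max_le (le_abs_self s) (abs_nonneg s))
      (by linarith)
  · have h : (fun s : ℝ => max s 0 ^ p) =ᶠ[nhds t] fun s => s ^ p := by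
      filter_upwards [Ioi_mem_nhds ht] with s hs
      rw [max_eq_left (le_of_lt hs)]
    rw [max_eq_left ht.le]
    exact (Real.hasDerivAt_rpow_const (Or.inl ht.ne')).congr_of_eventuallyEq h

/-- The kink of |s| at 0 does no harm, because the truncation vanishes for |s| < ε. -/
lemma hasDerivAt_truncation_rpow {p ε : ℝ} (hp : 1 < p) (hε : 0 < ε) (s : ℝ) :
    HasDerivAt (fun s : ℝ => max (|s| - ε) 0 ^ p)
      (p * max (|s| - ε) 0 ^ (p - 1) * (SignType.sign s : ℝ)) s := by
  rcases eq_or_ne s 0 with rfl | hs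
  · have h : (fun s : ℝ => max (|s| - ε) 0 ^ p) =ᶠ[nhds 0] fun _ => 0 := by
      filter_upwards [(continuous_abs.tendsto (0 : ℝ)).eventually
        (Iio_mem_nhds (by simpa using hε))] with s hs
      rw [max_eq_right (sub_nonpos.2 (le_of_lt hs)), Real.zero_rpow (by linarith)]
    simpa using (hasDerivAt_const (0 : ℝ) (0 : ℝ)).congr_of_eventuallyEq h
  · exact (hasDerivAt_max_zero_rpow hp (|s| - ε)).comp s ((hasDerivAt_abs hs).sub_const ε)

/-! ### The Hardy inequality for truncations supported off the walls -/

/-- Continuity is asked only on `K`, so factors singular on the walls are allowed once another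
factor vanishes off `K`. -/
lemma integrable_of_continuousOn_of_eq_zero {E : Type*} [MeasurableSpace E] [TopologicalSpace E]
    [T2Space E] [OpensMeasurableSpace E] {μ : Measure E} [IsFiniteMeasureOnCompacts μ] {K : Set E}
    (hK : IsCompact K) {h : E → ℝ} (hc : ContinuousOn h K) (h0 : ∀ x ∉ K, h x = 0) :
    Integrable h μ := by
  rw [← integrableOn_iff_integrable_of_support_subset (s := K)]
  · exact hc.integrableOn_compact' hK hK.measurableSet
  · intro x hx
    by_contra hxK
    exact hx (h0 x hxK)

/-- The points with distinct coordinates. -/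
def offWalls (d : ℕ) : Set (EuclideanSpace ℝ (Fin d)) := {x | ∀ i j, i ≠ j → x i ≠ x j}

lemma ne_zero_of_mem_offWalls {d : ℕ} (hd : 2 ≤ d) {x : EuclideanSpace ℝ (Fin d)}
    (hx : x ∈ offWalls d) : x ≠ 0 := by
  rintro rfl
  exact hx ⟨0, by omega⟩ ⟨1, by omega⟩ (by simp) rfl

lemma continuousOn_coord_sub_inv {d : ℕ} (i j : Fin d) :
    ContinuousOn (fun x : EuclideanSpace ℝ (Fin d) => (x i - x j)⁻¹) (offWalls d) := by
  by_cases h : i = j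
  · subst h
    simpa using continuousOn_const
  · exact ContinuousOn.inv₀ (by fun_prop) fun x hx => sub_ne_zero.2 (hx i j h)

lemma continuousOn_norm_sq_rpow {d : ℕ} (hd : 2 ≤ d) (q : ℝ) :
    ContinuousOn (fun x : EuclideanSpace ℝ (Fin d) => (‖x‖ ^ 2) ^ q) (offWalls d) :=
  ContinuousOn.rpow_const (by fun_prop) fun x hx =>
    Or.inl (by simpa using ne_zero_of_mem_offWalls hd hx)

lemma continuousOn_groundLogGrad {d : ℕ} (hd : 2 ≤ d) (β : ℝ) (i : Fin d) :
    ContinuousOn (fun x => groundLogGrad β x i) (offWalls d) := by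
  refine ContinuousOn.sub (continuousOn_finsetSum _ fun j _ => continuousOn_coord_sub_inv i j)
    (ContinuousOn.div (by fun_prop) (by fun_prop) fun x hx => ?_)
  simpa using ne_zero_of_mem_offWalls hd hx

lemma continuousOn_groundFieldDeriv {d : ℕ} (hd : 2 ≤ d) (q β : ℝ) (i : Fin d) :
    ContinuousOn (fun x => groundFieldDeriv q β x i) (offWalls d) := by
  have h1 := continuousOn_norm_sq_rpow hd q
  have h2 := continuousOn_norm_sq_rpow hd (q - 1)
  have h3 := continuousOn_groundLogGrad hd β i
  have h4 : ContinuousOn (fun x : EuclideanSpace ℝ (Fin d) => ∑ j, ((x i - x j)⁻¹) ^ 2)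
      (offWalls d) :=
    continuousOn_finsetSum _ fun j _ => (continuousOn_coord_sub_inv i j).pow 2
  have h5 : ContinuousOn (fun x : EuclideanSpace ℝ (Fin d) =>
      (β * ‖x‖ ^ 2 - β * x i * (2 * x i)) / (‖x‖ ^ 2) ^ 2) (offWalls d) := by
    refine ContinuousOn.div (by fun_prop) (by fun_prop) fun x hx => ?_
    simpa using ne_zero_of_mem_offWalls hd hx
  exact ContinuousOn.add ((ContinuousOn.mul (by fun_prop) h2).mul h3) (h1.mul (h4.neg.sub h5))

/-- The sum is `ℓ` applied to the vector with coordinates `G`, so the operator norm bound is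
Cauchy-Schwarz here. -/
lemma sum_apply_single_mul_le {d : ℕ} (ℓ : EuclideanSpace ℝ (Fin d) →L[ℝ] ℝ) (G : Fin d → ℝ) :
    |∑ i, ℓ (EuclideanSpace.single i 1) * G i| ≤ ‖ℓ‖ * √(∑ i, G i ^ 2) := by
  have h : ∑ i, ℓ (EuclideanSpace.single i 1) * G i = ℓ (WithLp.toLp 2 G) := by
    conv_rhs => rw [← (EuclideanSpace.basisFun (Fin d) ℝ).sum_repr (WithLp.toLp 2 G)]
    simp [mul_comm]
  rw [h]
  refine (ℓ.le_opNorm _).trans_eq ?_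
  simp [EuclideanSpace.norm_eq]

/-- The base of the power `p / 2` in `hardyConst`. -/
noncomputable def hardyBase (d : ℕ) (p : ℝ) : ℝ :=
  2 * (p - 2) * (d : ℝ) * ((d : ℝ) - 1) / p ^ 2 + (((d : ℝ) ^ 2 - p) / p) ^ 2

/-- The first term vanishes at p = 2 and the square at p = d²; never both, as d² > 2. -/
lemma hardyBase_pos {d : ℕ} (hd : 2 ≤ d) {p : ℝ} (hp : 2 ≤ p) : 0 < hardyBase d p := by
  have hd' : (2 : ℝ) ≤ d := by exact_mod_cast hd
  unfold hardyBase
  rcases eq_or_lt_of_le hp with rfl | hp2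
  · have : 0 < (((d : ℝ) ^ 2 - 2) / 2) ^ 2 := by
      have : 0 < (d : ℝ) ^ 2 - 2 := by nlinarith
      positivity
    simpa using this
  · have h1 : 0 < p - 2 := by linarith
    have h2 : 0 < (d : ℝ) - 1 := by linarith
    positivity

/-- The Hardy inequality for the truncations of a `C¹` function of compact support which vanishes
where two coordinates agree. -/
theorem hardy_truncation {d : ℕ} (hd : 2 ≤ d) {p : ℝ} (hp : 2 ≤ p)
    {v : EuclideanSpace ℝ (Fin d) → ℝ} (hv : ContDiff ℝ 1 v) (hvs : HasCompactSupport v)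
    (hwall : ∀ x, x ∉ offWalls d → v x = 0) {ε : ℝ} (hε : 0 < ε) :
    Integrable (fun x => max (|v x| - ε) 0 ^ p / ‖x‖ ^ p) ∧
    Integrable (fun x => ‖fderiv ℝ v x‖ ^ p) ∧
    hardyConst d p * ∫ x, max (|v x| - ε) 0 ^ p / ‖x‖ ^ p ≤ ∫ x, ‖fderiv ℝ v x‖ ^ p := by
  have hp0 : 0 < p := by linarith
  set K : Set (EuclideanSpace ℝ (Fin d)) := {x | ε ≤ |v x|} with hKdef
  have hKc : IsClosed K := isClosed_le continuous_const hv.continuous.abs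
  have hK : IsCompact K := by
    refine hvs.isCompact.of_isClosed_subset hKc fun x hx => subset_tsupport v ?_
    intro h0
    simp only [hKdef, Set.mem_ofPred_eq, h0, abs_zero] at hx
    linarith
  have hKU : K ⊆ offWalls d := by
    intro x hx
    by_contra h
    simp only [hKdef, Set.mem_ofPred_eq, hwall x h, abs_zero] at hx
    linarith
  set f : EuclideanSpace ℝ (Fin d) → ℝ := fun x => max (|v x| - ε) 0 ^ p with hf
  set Φ' : EuclideanSpace ℝ (Fin d) → ℝ :=
    fun x => p * max (|v x| - ε) 0 ^ (p - 1) * (SignType.sign (v x) : ℝ) with hΦ'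
  have hmax : ∀ x ∉ K, max (|v x| - ε) 0 = 0 := fun x hx =>
    max_eq_right (sub_nonpos.2 (not_le.1 hx).le)
  have hf0 : ∀ x ∉ K, f x = 0 := fun x hx => by
    simp only [hf, hmax x hx, Real.zero_rpow hp0.ne']
  have hΦ'0 : ∀ x ∉ K, Φ' x = 0 := fun x hx => by
    simp only [hΦ', hmax x hx, Real.zero_rpow (show p - 1 ≠ 0 by linarith), mul_zero, zero_mul]
  have hvc := hv.continuous
  have hfc : ContinuousOn f K :=
    (Continuous.rpow_const (by fun_prop) fun x => Or.inr hp0.le).continuousOn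
  have hΦ'c : ContinuousOn Φ' K := by
    refine ContinuousOn.mul (Continuous.continuousOn ?_) fun x hx => ?_
    · exact continuous_const.mul (Continuous.rpow_const (by fun_prop) fun x => Or.inr (by linarith))
    · have hvx : v x ≠ 0 := by
        intro h0
        simp only [hKdef, Set.mem_ofPred_eq, h0, abs_zero] at hx
        linarith
      have h1 : ContinuousAt (fun x => SignType.sign (v x)) x :=
        (continuousAt_sign_of_ne_zero hvx).comp hvc.continuousAt
      exact ((continuous_of_discreteTopology (f := fun σ : SignType => (σ : ℝ))).continuousAt.comp
        h1).continuousWithinAt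
  have hdv : ∀ i, Continuous fun x => fderiv ℝ v x (EuclideanSpace.single i 1) := fun i =>
    (hv.continuous_fderiv one_ne_zero).clm_apply continuous_const
  -- The weight (‖x‖²)^q is |x|^(-(p-2)). In the ground state equation d² - 2 + 2q = d² - p, so this
  -- `β` minimises the quadratic coefficient.
  set q : ℝ := -(p - 2) / 2 with hq
  set β : ℝ := ((d : ℝ) ^ 2 - p) / 2 with hβ
  set κ := hardyBase d p with hκdef
  have hκ : 0 < κ := hardyBase_pos hd hp
  have hKpos : ∀ x ∈ K, 0 < ‖x‖ := fun x hx => norm_pos_iff.2 (ne_zero_of_mem_offWalls hd (hKU hx))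
  have cq := (continuousOn_norm_sq_rpow hd q).mono hKU
  have cq1 := (continuousOn_norm_sq_rpow hd (q - 1)).mono hKU
  have cG := fun i => (continuousOn_groundLogGrad hd β i).mono hKU
  have cD := fun i => (continuousOn_groundFieldDeriv hd q β i).mono hKU
  have I1 : ∀ i, Integrable fun x => Φ' x * fderiv ℝ v x (EuclideanSpace.single i 1) *
      ((‖x‖ ^ 2) ^ q * groundLogGrad β x i) := fun i =>
    integrable_of_continuousOn_of_eq_zero hK
      ((hΦ'c.mul (hdv i).continuousOn).mul (cq.mul (cG i))) fun x hx => by simp [hΦ'0 x hx]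
  have I2 : ∀ i, Integrable fun x => f x * groundFieldDeriv q β x i := fun i =>
    integrable_of_continuousOn_of_eq_zero hK (hfc.mul (cD i)) fun x hx => by simp [hf0 x hx]
  have I3 : ∀ i, Integrable fun x => f x * ((‖x‖ ^ 2) ^ q * groundLogGrad β x i) := fun i =>
    integrable_of_continuousOn_of_eq_zero hK (hfc.mul (cq.mul (cG i)))
      fun x hx => by simp [hf0 x hx]
  have I4 : Integrable fun x => f x * (‖x‖ ^ 2) ^ q * ∑ i, groundLogGrad β x i ^ 2 :=
    integrable_of_continuousOn_of_eq_zero hK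
      ((hfc.mul cq).mul (continuousOn_finsetSum _ fun i _ => (cG i).pow 2))
      fun x hx => by simp [hf0 x hx]
  have I5 : Integrable fun x => f x * (‖x‖ ^ 2) ^ (q - 1) :=
    integrable_of_continuousOn_of_eq_zero hK (hfc.mul cq1) fun x hx => by simp [hf0 x hx]
  have I6 : Integrable fun x => ‖fderiv ℝ v x‖ ^ p := by
    refine integrable_of_continuousOn_of_eq_zero hvs.isCompact
      (((hv.continuous_fderiv one_ne_zero).norm).rpow_const fun x => Or.inr hp0.le).continuousOn
      fun x hx => ?_
    have : fderiv ℝ v x = 0 := by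
      by_contra h
      exact hx (support_fderiv_subset ℝ h)
    rw [this, norm_zero, Real.zero_rpow hp0.ne']
  have hfX : ∀ x, f x * (‖x‖ ^ 2) ^ (q - 1) = f x / ‖x‖ ^ p := by
    intro x
    rw [div_eq_mul_inv, ← Real.rpow_natCast, ← Real.rpow_mul (norm_nonneg x),
      ← Real.rpow_neg (norm_nonneg x)]
    congr 2
    rw [hq]; push_cast; ring
  -- No boundary term arises: the field need only be differentiable on the closed support of `f`,
  -- which lies in `K`.
  have hparts : ∀ i, ∫ x, f x * groundFieldDeriv q β x i =
      -∫ x, Φ' x * fderiv ℝ v x (EuclideanSpace.single i 1) *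
        ((‖x‖ ^ 2) ^ q * groundLogGrad β x i) := by
    intro i
    refine integral_bilinear_hasLineDerivAt_right_eq_neg_left_of_integrable
      (B := ContinuousLinearMap.mul ℝ ℝ) (v := EuclideanSpace.single i 1) (I1 i) (I2 i) (I3 i)
      (fun x _ => ?_) fun x hx => ?_
    · have h1 : HasFDerivAt v (fderiv ℝ v x) x :=
        (hv.differentiable one_ne_zero x).hasFDerivAt
      have h2 := (hasDerivAt_truncation_rpow (show 1 < p by linarith) hε (v x)).comp_hasFDerivAt x h1
      exact h2.hasLineDerivAt (EuclideanSpace.single i 1)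
    · have hxK : x ∈ K := by
        refine closure_minimal (fun y hy => ?_) hKc hx
        by_contra h
        exact hy (hf0 y h)
      exact hasLineDerivAt_groundField q β (hKU hxK) (norm_pos_iff.1 (hKpos x hxK)) i
  have hdiv : ∑ i, ∫ x, f x * groundFieldDeriv q β x i =
      -(p ^ 2 * κ / 4) * (∫ x, f x * (‖x‖ ^ 2) ^ (q - 1)) -
        ∫ x, f x * (‖x‖ ^ 2) ^ q * ∑ i, groundLogGrad β x i ^ 2 := by
    rw [← integral_finsetSum _ fun i _ => I2 i, ← integral_const_mul,
      ← integral_sub (I5.const_mul _) I4]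
    congr 1 with x
    by_cases hx : x ∈ K
    · have h := sum_groundFieldDeriv_add q β (hKU hx) (norm_pos_iff.1 (hKpos x hx))
      have hc : β ^ 2 - β * ((d : ℝ) ^ 2 - 2 + 2 * q) + q * d * (d - 1) = -(p ^ 2 * κ / 4) := by
        rw [hκdef, hβ, hq, hardyBase]
        field_simp
        ring
      rw [hc] at h
      rw [← Finset.mul_sum]
      linear_combination f x * h
    · simp [hf0 x hx]
  have hpoint : ∀ x, κ ^ ((p - 2) / 2) *
      (2 / p * ∑ i, Φ' x * fderiv ℝ v x (EuclideanSpace.single i 1) *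
        ((‖x‖ ^ 2) ^ q * groundLogGrad β x i)
      - 2 / p * (f x * (‖x‖ ^ 2) ^ q * ∑ i, groundLogGrad β x i ^ 2)
      - (p - 2) / 2 * κ * (f x * (‖x‖ ^ 2) ^ (q - 1))) ≤ ‖fderiv ℝ v x‖ ^ p := by
    intro x
    by_cases hx : x ∈ K
    · set g := √(∑ i, groundLogGrad β x i ^ 2) with hg
      have hg2 : ∑ i, groundLogGrad β x i ^ 2 = g ^ 2 :=
        (Real.sq_sqrt (Finset.sum_nonneg fun i _ => sq_nonneg _)).symm
      set a := max (|v x| - ε) 0 with ha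
      have ha0 : 0 ≤ a := le_max_right _ _
      refine le_trans ?_ (rpow_ge_of_young (g := g) hp ha0 (hKpos x hx)
        (norm_nonneg (fderiv ℝ v x)) hκ)
      rw [hg2]
      refine mul_le_mul_of_nonneg_left ?_ (by positivity)
      have hsum : 2 / p * ∑ i, Φ' x * fderiv ℝ v x (EuclideanSpace.single i 1) *
          ((‖x‖ ^ 2) ^ q * groundLogGrad β x i) = 2 * a ^ (p - 1) * (‖x‖ ^ 2) ^ q *
          ((SignType.sign (v x) : ℝ) *
            ∑ i, fderiv ℝ v x (EuclideanSpace.single i 1) * groundLogGrad β x i) := by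
        simp only [Finset.mul_sum]
        refine Finset.sum_congr rfl fun i _ => ?_
        simp only [hΦ', ← ha]
        field_simp
      have hle : (SignType.sign (v x) : ℝ) *
          ∑ i, fderiv ℝ v x (EuclideanSpace.single i 1) * groundLogGrad β x i ≤
          ‖fderiv ℝ v x‖ * g := by
        refine (le_abs_self _).trans ?_
        rw [abs_mul]
        refine (mul_le_of_le_one_left (abs_nonneg _) ?_).trans (sum_apply_single_mul_le _ _)
        rcases lt_trichotomy (v x) 0 with h | h | h <;> simp [h]
      rw [hsum]
      simp only [hf, ← ha]
      have : 0 ≤ 2 * a ^ (p - 1) * (‖x‖ ^ 2) ^ q := by positivity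
      gcongr
    · simp only [hΦ'0 x hx, hf0 x hx, zero_mul, Finset.sum_const_zero, mul_zero, sub_zero]
      positivity
  refine ⟨by simpa only [hfX] using I5, I6, ?_⟩
  have J1 : Integrable fun x => ∑ i, Φ' x * fderiv ℝ v x (EuclideanSpace.single i 1) *
      ((‖x‖ ^ 2) ^ q * groundLogGrad β x i) := integrable_finsetSum _ fun i _ => I1 i
  have hint := integral_mono ((((J1.const_mul (2 / p)).sub (I4.const_mul (2 / p))).sub
    (I5.const_mul ((p - 2) / 2 * κ))).const_mul (κ ^ ((p - 2) / 2))) I6 hpoint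
  refine le_trans (le_of_eq ?_) hint
  have e : (fun x => max (|v x| - ε) 0 ^ p / ‖x‖ ^ p) = fun x => f x * (‖x‖ ^ 2) ^ (q - 1) :=
    funext fun x => (hfX x).symm
  rw [e, integral_const_mul]
  rw [integral_sub' ((J1.const_mul (2 / p)).sub (I4.const_mul (2 / p)))
    (I5.const_mul ((p - 2) / 2 * κ)), integral_sub' (J1.const_mul (2 / p)) (I4.const_mul (2 / p)),
    integral_const_mul, integral_const_mul, integral_const_mul,
    integral_finsetSum _ fun i _ => I1 i]
  simp only [hparts, Finset.sum_neg_distrib] at hdiv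
  have hconst : hardyConst d p = κ ^ ((p - 2) / 2) * κ := by
    rw [← Real.rpow_add_one hκ.ne', hardyConst, hκdef, hardyBase]
    congr 1; ring
  rw [hconst, mul_assoc]
  congr 1
  -- What remains is (2/p)(p²κ/4) - (p-2)κ/2 = κ; the integrals of f |x|^(-(p-2)) |G|² cancel.
  rw [neg_eq_iff_eq_neg.1 hdiv]
  field_simp
  ring

/-! ### Radial cutoffs and mollifiers -/

/-- A radial smooth function of compact support which is `1` on the unit ball. -/
noncomputable def radialBump {d : ℕ} (x : EuclideanSpace ℝ (Fin d)) : ℝ :=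
  Real.smoothTransition (2 - ‖x‖ ^ 2)

section radialBump

variable {d : ℕ}

lemma contDiff_radialBump : ContDiff ℝ ∞ (radialBump (d := d)) :=
  Real.smoothTransition.contDiff.comp (contDiff_const.sub (contDiff_norm_sq ℝ))

lemma radialBump_nonneg (x : EuclideanSpace ℝ (Fin d)) : 0 ≤ radialBump x :=
  Real.smoothTransition.nonneg _

lemma radialBump_le_one (x : EuclideanSpace ℝ (Fin d)) : radialBump x ≤ 1 :=
  Real.smoothTransition.le_one _

lemma radialBump_eq_one {x : EuclideanSpace ℝ (Fin d)} (hx : ‖x‖ ≤ 1) : radialBump x = 1 :=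
  Real.smoothTransition.one_of_one_le (by nlinarith [norm_nonneg x])

lemma radialBump_eq_zero {x : EuclideanSpace ℝ (Fin d)} (hx : 2 < ‖x‖) : radialBump x = 0 :=
  Real.smoothTransition.zero_of_nonpos (by nlinarith [norm_nonneg x])

lemma radialBump_congr {x y : EuclideanSpace ℝ (Fin d)} (h : ‖x‖ = ‖y‖) :
    radialBump x = radialBump y := by
  simp [radialBump, h]

lemma contDiff_radialBump_scaled (r : ℝ) :
    ContDiff ℝ ∞ (fun x : EuclideanSpace ℝ (Fin d) => radialBump (r⁻¹ • x)) :=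
  contDiff_radialBump.comp (contDiff_const_smul _)

lemma radialBump_scaled_eq_zero {r : ℝ} (hr : 0 < r) {x : EuclideanSpace ℝ (Fin d)}
    (hx : x ∉ Metric.closedBall 0 (2 * r)) : radialBump (r⁻¹ • x) = 0 := by
  apply radialBump_eq_zero
  rw [norm_smul, norm_inv, Real.norm_of_nonneg hr.le, inv_mul_eq_div, lt_div_iff₀ hr]
  simpa using hx

lemma hasCompactSupport_radialBump_scaled {r : ℝ} (hr : 0 < r) :
    HasCompactSupport (fun x : EuclideanSpace ℝ (Fin d) => radialBump (r⁻¹ • x)) :=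
  HasCompactSupport.intro (isCompact_closedBall 0 (2 * r))
    fun _ hx => radialBump_scaled_eq_zero hr hx

lemma integrable_radialBump_scaled {r : ℝ} (hr : 0 < r) :
    Integrable (fun x : EuclideanSpace ℝ (Fin d) => radialBump (r⁻¹ • x)) :=
  (contDiff_radialBump_scaled r).continuous.integrable_of_hasCompactSupport
    (hasCompactSupport_radialBump_scaled hr)

lemma volume_closedBall_le_integral_radialBump {r : ℝ} (hr : 0 < r) :
    volume.real (Metric.closedBall (0 : EuclideanSpace ℝ (Fin d)) r) ≤
      ∫ x : EuclideanSpace ℝ (Fin d), radialBump (r⁻¹ • x) := by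
  rw [← integral_indicator_one Metric.isClosed_closedBall.measurableSet]
  refine integral_mono ?_ (integrable_radialBump_scaled hr) fun x => ?_
  · exact (integrable_indicator_iff Metric.isClosed_closedBall.measurableSet).2
      (integrableOn_const (isCompact_closedBall _ _).measure_lt_top.ne)
  · by_cases hx : x ∈ Metric.closedBall (0 : EuclideanSpace ℝ (Fin d)) r
    · have : radialBump (r⁻¹ • x) = 1 := by
        apply radialBump_eq_one
        rw [norm_smul, norm_inv, Real.norm_of_nonneg hr.le, inv_mul_eq_div, div_le_one hr]
        simpa using hx
      simp [hx, this]
    · simp [hx, radialBump_nonneg]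

/-- The radial mollifier at scale `r`. -/
noncomputable def mollifier (r : ℝ) (x : EuclideanSpace ℝ (Fin d)) : ℝ :=
  (∫ y : EuclideanSpace ℝ (Fin d), radialBump (r⁻¹ • y))⁻¹ * radialBump (r⁻¹ • x)

lemma volume_closedBall_pos (x : EuclideanSpace ℝ (Fin d)) {r : ℝ} (hr : 0 < r) :
    0 < volume.real (Metric.closedBall x r) :=
  ENNReal.toReal_pos (Metric.measure_closedBall_pos _ _ hr).ne'
    (isCompact_closedBall _ _).measure_lt_top.ne

lemma integral_radialBump_pos {r : ℝ} (hr : 0 < r) :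
    0 < ∫ y : EuclideanSpace ℝ (Fin d), radialBump (r⁻¹ • y) :=
  (volume_closedBall_pos 0 hr).trans_le (volume_closedBall_le_integral_radialBump hr)

lemma contDiff_mollifier (r : ℝ) : ContDiff ℝ ∞ (mollifier (d := d) r) :=
  contDiff_const.mul (contDiff_radialBump_scaled r)

lemma mollifier_nonneg {r : ℝ} (hr : 0 < r) (x : EuclideanSpace ℝ (Fin d)) : 0 ≤ mollifier r x :=
  mul_nonneg (inv_nonneg.2 (integral_radialBump_pos hr).le) (radialBump_nonneg _)

lemma mollifier_eq_zero {r : ℝ} (hr : 0 < r) {x : EuclideanSpace ℝ (Fin d)}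
    (hx : x ∉ Metric.closedBall 0 (2 * r)) : mollifier r x = 0 := by
  rw [mollifier, radialBump_scaled_eq_zero hr hx, mul_zero]

lemma hasCompactSupport_mollifier {r : ℝ} (hr : 0 < r) : HasCompactSupport (mollifier (d := d) r) :=
  HasCompactSupport.intro (isCompact_closedBall 0 (2 * r)) fun _ hx => mollifier_eq_zero hr hx

lemma integral_mollifier {r : ℝ} (hr : 0 < r) :
    ∫ x : EuclideanSpace ℝ (Fin d), mollifier r x = 1 := by
  simp only [mollifier]
  rw [integral_const_mul, inv_mul_cancel₀ (integral_radialBump_pos hr).ne']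

lemma mollifier_congr (r : ℝ) {x y : EuclideanSpace ℝ (Fin d)} (h : ‖x‖ = ‖y‖) :
    mollifier r x = mollifier r y := by
  rw [mollifier, mollifier, radialBump_congr (x := r⁻¹ • x) (y := r⁻¹ • y) (by simp [norm_smul, h])]

/-- The ball of radius 2r contains the support, while the normalising integral is at least the
volume of a ball of radius r; 2^d is the ratio of volumes. Uniformity in `r` is what the convergence
at Lebesgue points needs. -/
lemma mollifier_le {r : ℝ} (hr : 0 < r) (x z : EuclideanSpace ℝ (Fin d)) :
    mollifier r x ≤ 2 ^ d / volume.real (Metric.closedBall z (2 * r)) := by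
  have h1 := volume_closedBall_le_integral_radialBump (d := d) hr
  have h2 : volume.real (Metric.closedBall z (2 * r)) =
      2 ^ d * volume.real (Metric.closedBall (0 : EuclideanSpace ℝ (Fin d)) r) := by
    rw [Measure.addHaar_real_closedBall' _ _ (by positivity),
      Measure.addHaar_real_closedBall' _ _ hr.le, mul_pow, mul_assoc]
    simp
  rw [h2, mollifier, div_mul_eq_div_div, div_self (by positivity), one_div]
  calc _ ≤ (∫ y : EuclideanSpace ℝ (Fin d), radialBump (r⁻¹ • y))⁻¹ * 1 := by
        have := integral_radialBump_pos (d := d) hr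
        gcongr
        exact radialBump_le_one _
    _ ≤ _ := by
        rw [mul_one]
        exact inv_anti₀ (volume_closedBall_pos 0 hr) h1

/-- Lebesgue points: mollifications converge almost everywhere. -/
lemma ae_tendsto_mollifier {u : EuclideanSpace ℝ (Fin d) → ℝ} (hu : LocallyIntegrable u)
    {r : ℕ → ℝ} (hr : ∀ n, 0 < r n) (hr0 : Filter.Tendsto r Filter.atTop (nhds 0)) :
    ∀ᵐ x, Filter.Tendsto (fun n => ∫ y, mollifier (r n) (x - y) • u y) Filter.atTop
      (nhds (u x)) := by
  filter_upwards [(Besicovitch.vitaliFamily volume).ae_tendsto_average_norm_sub hu] with x hx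
  have hr' : Filter.Tendsto (fun n => 2 * r n) Filter.atTop (nhdsWithin 0 (Set.Ioi 0)) := by
    refine tendsto_nhdsWithin_iff.2 ⟨by simpa using hr0.const_mul 2,
      Filter.Eventually.of_forall fun n => ?_⟩
    exact mul_pos two_pos (hr n)
  have := (hx.comp (Besicovitch.tendsto_filterAt volume x)).comp hr'
  apply tendsto_integral_smul_of_tendsto_average_norm_sub (2 ^ d) this
  · exact Filter.Eventually.of_forall fun n =>
      hu.integrableOn_isCompact (isCompact_closedBall _ _)
  · refine tendsto_const_nhds.congr fun n => ?_
    rw [integral_sub_left_eq_self (fun y => mollifier (r n) y), integral_mollifier (hr n)]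
  · refine Filter.Eventually.of_forall fun n y hy => ?_
    by_contra h
    refine hy (mollifier_eq_zero (hr n) ?_)
    simpa [dist_eq_norm_sub', norm_sub_rev] using h
  · refine Filter.Eventually.of_forall fun n y => ?_
    rw [abs_of_nonneg (mollifier_nonneg (hr n) _)]
    exact mollifier_le (hr n) _ _

end radialBump

/-! ### Mollification in L^p and of weak gradients -/

/-- Mollification does not increase `Lᵖ` norms. -/
lemma eLpNorm_mollify_le {E F : Type*} [NormedAddCommGroup E] [MeasurableSpace E]
    [BorelSpace E] [SecondCountableTopology E] {μ : Measure E} [SigmaFinite μ]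
    [μ.IsAddLeftInvariant] [μ.IsNegInvariant]
    [NormedAddCommGroup F] [NormedSpace ℝ F]
    {ρ : E → ℝ} (hρ0 : ∀ x, 0 ≤ ρ x) (hρc : Continuous ρ) (hρi : Integrable ρ μ)
    (hρ1 : ∫ x, ρ x ∂μ = 1) {f : E → F} (hf : AEStronglyMeasurable f μ) {p : ENNReal}
    (hp : 1 ≤ p) (hp' : p ≠ ⊤) :
    eLpNorm (fun x => ∫ y, ρ (x - y) • f y ∂μ) p μ ≤ eLpNorm f p μ := by
  have hp0 : p ≠ 0 := (zero_lt_one.trans_le hp).ne'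
  have hpr : 0 < p.toReal := ENNReal.toReal_pos hp0 hp'
  have hl1 : ∫⁻ x, ENNReal.ofReal (ρ x) ∂μ = 1 := by
    rw [← ofReal_integral_eq_lintegral_ofReal hρi (Filter.Eventually.of_forall hρ0), hρ1,
      ENNReal.ofReal_one]
  have hmeas : ∀ x, Measurable fun y => ENNReal.ofReal (ρ (x - y)) := fun x =>
    (hρc.comp (continuous_const.sub continuous_id)).measurable.ennreal_ofReal
  have hjensen : ∀ x, ‖∫ y, ρ (x - y) • f y ∂μ‖ₑ ^ p.toReal ≤
      ∫⁻ y, ENNReal.ofReal (ρ (x - y)) * ‖f y‖ₑ ^ p.toReal ∂μ := by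
    intro x
    -- The translated kernel is a probability density, so Jensen's inequality becomes monotonicity
    -- of L^p norms in the exponent.
    set ν := μ.withDensity fun y => ENNReal.ofReal (ρ (x - y)) with hν
    have hprob : IsProbabilityMeasure ν := by
      refine ⟨?_⟩
      rw [hν, withDensity_apply _ MeasurableSet.univ, Measure.restrict_univ,
        lintegral_sub_left_eq_self (fun y => ENNReal.ofReal (ρ y)), hl1]
    have hfν : AEStronglyMeasurable f ν := hf.mono_ac (withDensity_absolutelyContinuous _ _)
    have h1 : ‖∫ y, ρ (x - y) • f y ∂μ‖ₑ ≤ eLpNorm f 1 ν := by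
      refine (enorm_integral_le_lintegral_enorm _).trans_eq ?_
      rw [eLpNorm_one_eq_lintegral_enorm, hν,
        lintegral_withDensity_eq_lintegral_mul₀ (hmeas x).aemeasurable hf.enorm]
      refine lintegral_congr fun y => ?_
      simp [enorm_smul, Real.enorm_of_nonneg (hρ0 _)]
    have h2 := h1.trans (eLpNorm_le_eLpNorm_of_exponent_le hp hfν)
    rw [eLpNorm_eq_lintegral_rpow_enorm_toReal hp0 hp'] at h2
    refine (ENNReal.rpow_le_rpow h2 hpr.le).trans_eq ?_
    rw [← ENNReal.rpow_mul, one_div_mul_cancel hpr.ne', ENNReal.rpow_one, hν,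
      lintegral_withDensity_eq_lintegral_mul₀ (hmeas x).aemeasurable (hf.enorm.pow_const _)]
    rfl
  rw [eLpNorm_eq_lintegral_rpow_enorm_toReal hp0 hp', eLpNorm_eq_lintegral_rpow_enorm_toReal hp0 hp']
  refine ENNReal.rpow_le_rpow ?_ (by positivity)
  calc ∫⁻ x, ‖∫ y, ρ (x - y) • f y ∂μ‖ₑ ^ p.toReal ∂μ
      ≤ ∫⁻ x, ∫⁻ y, ENNReal.ofReal (ρ (x - y)) * ‖f y‖ₑ ^ p.toReal ∂μ ∂μ := lintegral_mono hjensen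
    _ = ∫⁻ y, ∫⁻ x, ENNReal.ofReal (ρ (x - y)) * ‖f y‖ₑ ^ p.toReal ∂μ ∂μ := by
        refine lintegral_lintegral_swap (AEMeasurable.mul ?_ ?_)
        · exact (hρc.comp (continuous_fst.sub continuous_snd)).measurable.ennreal_ofReal.aemeasurable
        · exact (hf.enorm.pow_const p.toReal).comp_quasiMeasurePreserving
            Measure.quasiMeasurePreserving_snd
    _ = ∫⁻ y, ‖f y‖ₑ ^ p.toReal ∂μ := by
        refine lintegral_congr fun y => ?_
        have hm : Measurable fun x => ENNReal.ofReal (ρ (x - y)) :=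
          (hρc.comp (continuous_id.sub continuous_const)).measurable.ennreal_ofReal
        rw [lintegral_mul_const _ hm, lintegral_sub_right_eq_self (fun x => ENNReal.ofReal (ρ x)), hl1, one_mul]

section gradient

variable {d : ℕ} {u : EuclideanSpace ℝ (Fin d) → ℝ}
  {g : EuclideanSpace ℝ (Fin d) → EuclideanSpace ℝ (Fin d)} {ρ : EuclideanSpace ℝ (Fin d) → ℝ}

lemma mollify_eq_convolution (ρ u : EuclideanSpace ℝ (Fin d) → ℝ) :
    (fun x => ∫ y, ρ (x - y) • u y) =
      convolution ρ u (ContinuousLinearMap.lsmul ℝ ℝ) volume :=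
  funext fun _ => convolution_lsmul_swap.symm

lemma contDiff_mollify (hu : LocallyIntegrable u) (hρ : ContDiff ℝ ∞ ρ)
    (hρs : HasCompactSupport ρ) : ContDiff ℝ 1 (fun x => ∫ y, ρ (x - y) • u y) := by
  rw [mollify_eq_convolution]
  exact hρs.contDiff_convolution_left (ContinuousLinearMap.lsmul ℝ ℝ) (n := 1)
    (hρ.of_le (by exact_mod_cast le_top)) hu

lemma integrable_mollifier_smul {F : Type*} [NormedAddCommGroup F] [NormedSpace ℝ F]
    {f : EuclideanSpace ℝ (Fin d) → F} (hf : LocallyIntegrable f) (hρ : Continuous ρ)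
    (hρs : HasCompactSupport ρ) (x : EuclideanSpace ℝ (Fin d)) :
    Integrable fun y => ρ (x - y) • f y :=
  hf.integrable_smul_left_of_hasCompactSupport (hρ.comp (continuous_const.sub continuous_id))
    (hρs.comp_homeomorph (Homeomorph.subLeft x))

/-- The gradient of the mollification is the mollification of the weak gradient. -/
lemma norm_fderiv_mollify_le (hug : IsWeakGradient u g) (hρ : ContDiff ℝ ∞ ρ)
    (hρs : HasCompactSupport ρ) (x : EuclideanSpace ℝ (Fin d)) :
    ‖fderiv ℝ (fun x => ∫ y, ρ (x - y) • u y) x‖ ≤ ‖∫ y, ρ (x - y) • g y‖ := by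
  obtain ⟨hu, hg, hw⟩ := hug
  have hρ1 : ContDiff ℝ 1 ρ := hρ.of_le (by exact_mod_cast le_top)
  have hd := hρs.hasFDerivAt_convolution_left (ContinuousLinearMap.lsmul ℝ ℝ) (μ := volume) hρ1 hu x
  have hex := (hρs.fderiv ℝ).convolutionExists_left
    ((ContinuousLinearMap.lsmul ℝ ℝ).precompL (EuclideanSpace ℝ (Fin d))) (μ := volume)
    (hρ1.continuous_fderiv one_ne_zero) hu x
  have hfd : ∀ z, fderiv ℝ (fun x => ∫ y, ρ (x - y) • u y) x z =
      ∫ y, fderiv ℝ ρ (x - y) z * u y := by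
    intro z
    rw [mollify_eq_convolution, hd.fderiv, convolution_def, ContinuousLinearMap.integral_apply hex]
    rw [← integral_sub_left_eq_self _ volume x]
    simp
  have hcoord : ∀ i, fderiv ℝ (fun x => ∫ y, ρ (x - y) • u y) x (EuclideanSpace.single i 1) =
      (∫ y, ρ (x - y) • g y) i := by
    intro i
    -- Testing the weak gradient with y ↦ ρ(x - y): the sign from the inner derivative cancels the
    -- one in the definition.
    have hφ : ContDiff ℝ ∞ fun y => ρ (x - y) := hρ.comp (contDiff_const.sub contDiff_id)
    have h := hw (fun y => ρ (x - y)) hφ (hρs.comp_homeomorph (Homeomorph.subLeft x)) i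
    have hder : ∀ y, fderiv ℝ (fun y => ρ (x - y)) y = -fderiv ℝ ρ (x - y) := fun y => by
      have h1 : HasFDerivAt ρ (fderiv ℝ ρ (x - y)) (x - y) :=
        (hρ1.differentiable one_ne_zero _).hasFDerivAt
      have h2 := h1.comp y ((hasFDerivAt_id y).const_sub x)
      exact h2.fderiv.trans (by simp)
    simp only [hder, neg_apply, mul_neg, integral_neg, neg_inj] at h
    rw [hfd]
    have hproj := (EuclideanSpace.proj (𝕜 := ℝ) i : EuclideanSpace ℝ (Fin d) →L[ℝ] ℝ).integral_comp_comm
      (integrable_mollifier_smul hg hρ.continuous hρs x)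
    refine Eq.trans ?_ hproj
    simpa [mul_comm] using h
  refine ContinuousLinearMap.opNorm_le_bound _ (norm_nonneg _) fun z => ?_
  have : fderiv ℝ (fun x => ∫ y, ρ (x - y) • u y) x z = inner ℝ (∫ y, ρ (x - y) • g y) z := by
    conv_lhs => rw [← (EuclideanSpace.basisFun (Fin d) ℝ).sum_repr z]
    simp only [map_sum, map_smul, EuclideanSpace.basisFun_apply, EuclideanSpace.basisFun_repr,
      hcoord, PiLp.inner_apply]
    simp
  rw [this]
  exact norm_inner_le_norm _ _

end gradient

/-! ### Antisymmetry and vanishing on the walls -/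

/-- The linear isometry interchanging two coordinates. -/
noncomputable def swapIsometry {d : ℕ} (i j : Fin d) :
    EuclideanSpace ℝ (Fin d) ≃ₗᵢ[ℝ] EuclideanSpace ℝ (Fin d) :=
  LinearIsometryEquiv.piLpCongrLeft 2 ℝ ℝ (Equiv.swap i j)

lemma swapIsometry_apply {d : ℕ} (i j : Fin d) (x : EuclideanSpace ℝ (Fin d)) :
    swapIsometry i j x = swapCoord i j x := by
  ext k
  simp [swapIsometry, swapCoord, LinearIsometryEquiv.piLpCongrLeft_apply, Equiv.piCongrLeft'_apply]

/-- Radial mollifications of antisymmetric functions vanish where two coordinates agree. -/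
lemma mollify_eq_zero_of_antisymmetric {d : ℕ} {u : EuclideanSpace ℝ (Fin d) → ℝ}
    (hu : IsAntisymmetric u) (r : ℝ) {x : EuclideanSpace ℝ (Fin d)} (hx : x ∉ offWalls d) :
    ∫ y, mollifier r (x - y) • u y = 0 := by
  simp only [offWalls, Set.mem_ofPred_eq, not_forall, not_not] at hx
  obtain ⟨i, j, hij, hxij⟩ := hx
  -- As the swap fixes `x` and the kernel is radial, the change of variables turns the integral into
  -- its own negative.
  have hfix : swapIsometry i j x = x := by
    rw [swapIsometry_apply]
    ext k
    simp only [swapCoord]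
    by_cases hki : k = i
    · subst hki; simp [hxij]
    · by_cases hkj : k = j
      · subst hkj; simp [hxij]
      · rw [Equiv.swap_apply_of_ne_of_ne hki hkj]
  have h := (swapIsometry i j).measurePreserving.integral_comp
    (swapIsometry i j).toHomeomorph.measurableEmbedding (fun y => mollifier r (x - y) • u y)
  have h2 : ∫ y, mollifier r (x - swapIsometry i j y) • u (swapIsometry i j y) =
      -∫ y, mollifier r (x - y) • u y := by
    rw [← integral_neg]
    refine integral_congr_ae ?_
    filter_upwards [hu i j hij] with y hy
    rw [swapIsometry_apply, hy, ← swapIsometry_apply,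
      mollifier_congr r (x := x - swapIsometry i j y) (y := x - y)]
    · simp
    · conv_lhs => rw [← hfix, ← map_sub, LinearIsometryEquiv.norm_map]
  rw [h2] at h
  linarith

/-! ### Uniqueness of weak gradients, and the approximating sequence -/

/-- Weak gradients are unique up to null sets. -/
lemma IsWeakGradient.ae_eq {d : ℕ} {u : EuclideanSpace ℝ (Fin d) → ℝ}
    {g h : EuclideanSpace ℝ (Fin d) → EuclideanSpace ℝ (Fin d)}
    (hg : IsWeakGradient u g) (hh : IsWeakGradient u h) : g =ᵐ[volume] h := by
  have key : ∀ i, ∀ᵐ x, g x i - h x i = 0 := by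
    intro i
    have hi : ∀ f : EuclideanSpace ℝ (Fin d) → EuclideanSpace ℝ (Fin d),
        LocallyIntegrable f → LocallyIntegrable fun x => f x i := by
      intro f hf x
      obtain ⟨s, hs, hfs⟩ := hf x
      exact ⟨s, hs, (EuclideanSpace.proj (𝕜 := ℝ) i).integrable_comp hfs⟩
    have hgi := hi g hg.2.1
    have hhi := hi h hh.2.1
    refine ae_eq_zero_of_integral_contDiff_smul_eq_zero (hgi.sub hhi) fun φ hφ hφs => ?_
    have h1 := hg.2.2 φ hφ hφs i
    have h2 := hh.2.2 φ hφ hφs i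
    have e1 := hgi.integrable_smul_left_of_hasCompactSupport hφ.continuous hφs
    have e2 := hhi.integrable_smul_left_of_hasCompactSupport hφ.continuous hφs
    simp only [smul_sub]
    rw [integral_sub e1 e2]
    simp only [smul_eq_mul, mul_comm (φ _)]
    linarith
  filter_upwards [ae_all_iff.2 key] with x hx
  ext i
  exact sub_eq_zero.1 (hx i)

lemma hardyConst_pos {d : ℕ} (hd : 2 ≤ d) {p : ℝ} (hp : 2 ≤ p) : 0 < hardyConst d p :=
  Real.rpow_pos_of_pos (hardyBase_pos hd hp) _

lemma exists_norm_fderiv_radialBump_scaled_le (d : ℕ) : ∃ C : ℝ, 0 ≤ C ∧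
    ∀ r : ℝ, 0 < r → ∀ x : EuclideanSpace ℝ (Fin d),
      ‖fderiv ℝ (fun y : EuclideanSpace ℝ (Fin d) => radialBump (r⁻¹ • y)) x‖ ≤ C / r := by
  have hb1 : ContDiff ℝ 1 (radialBump (d := d)) :=
    contDiff_radialBump.of_le (by exact_mod_cast le_top)
  have hbs : HasCompactSupport (radialBump (d := d)) := by
    simpa using hasCompactSupport_radialBump_scaled (d := d) one_pos
  obtain ⟨C, hC⟩ := (hbs.fderiv ℝ).exists_bound_of_continuous
    (hb1.continuous_fderiv one_ne_zero)
  refine ⟨C, (norm_nonneg _).trans (hC 0), fun r hr x => ?_⟩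
  rw [fderiv_comp_smul, norm_smul, norm_inv, Real.norm_of_nonneg hr.le, inv_mul_eq_div]
  gcongr
  exact hC _

/-- The product of the cutoff and the mollification of `u` at the scale of index `n`. -/
noncomputable def smoothApprox {d : ℕ} (u : EuclideanSpace ℝ (Fin d) → ℝ) (n : ℕ)
    (x : EuclideanSpace ℝ (Fin d)) : ℝ :=
  radialBump (((n : ℝ) + 1)⁻¹ • x) * ∫ y, mollifier (1 / ((n : ℝ) + 1)) (x - y) • u y

section smoothApprox

variable {d : ℕ} {u : EuclideanSpace ℝ (Fin d) → ℝ}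

lemma contDiff_smoothApprox (hu : LocallyIntegrable u) (n : ℕ) :
    ContDiff ℝ 1 (smoothApprox u n) :=
  ((contDiff_radialBump_scaled _).of_le (by exact_mod_cast le_top)).mul
    (contDiff_mollify hu (contDiff_mollifier _) (hasCompactSupport_mollifier (by positivity)))

lemma hasCompactSupport_smoothApprox (n : ℕ) : HasCompactSupport (smoothApprox u n) :=
  (hasCompactSupport_radialBump_scaled (by positivity)).mul_right

lemma smoothApprox_eq_zero (hu : IsAntisymmetric u) (n : ℕ) {x : EuclideanSpace ℝ (Fin d)}
    (hx : x ∉ offWalls d) : smoothApprox u n x = 0 := by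
  rw [smoothApprox, mollify_eq_zero_of_antisymmetric hu _ hx, mul_zero]

lemma ae_tendsto_smoothApprox (hu : LocallyIntegrable u) :
    ∀ᵐ x, Filter.Tendsto (fun n => smoothApprox u n x) Filter.atTop (nhds (u x)) := by
  filter_upwards [ae_tendsto_mollifier hu (r := fun n => 1 / ((n : ℝ) + 1))
    (fun n => by positivity) tendsto_one_div_add_atTop_nhds_zero_nat] with x hx
  have h1 : Filter.Tendsto (fun n : ℕ => radialBump (((n : ℝ) + 1)⁻¹ • x)) Filter.atTop
      (nhds 1) := by
    refine tendsto_const_nhds.congr' ?_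
    obtain ⟨N, hN⟩ := exists_nat_ge ‖x‖
    filter_upwards [Filter.eventually_ge_atTop N] with n hn
    refine (radialBump_eq_one ?_).symm
    have hn' : (N : ℝ) ≤ n := by exact_mod_cast hn
    rw [norm_smul, norm_inv, Real.norm_of_nonneg (by positivity), inv_mul_eq_div,
      div_le_one (by positivity)]
    linarith
  have h := h1.mul hx
  rw [one_mul] at h
  exact h

/-- Product rule: the cutoff is at most 1 in front of the mollified gradient, and its own gradient
is O(1/(n+1)) since it lives at scale n+1. -/
lemma eLpNorm_fderiv_smoothApprox_le {g : EuclideanSpace ℝ (Fin d) → EuclideanSpace ℝ (Fin d)}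
    (hug : IsWeakGradient u g) {p : ENNReal} (hp : 1 ≤ p) (hp' : p ≠ ⊤) {C : ℝ}
    (hC : ∀ r : ℝ, 0 < r → ∀ x : EuclideanSpace ℝ (Fin d),
      ‖fderiv ℝ (fun y : EuclideanSpace ℝ (Fin d) => radialBump (r⁻¹ • y)) x‖ ≤ C / r) (n : ℕ) :
    eLpNorm (fderiv ℝ (smoothApprox u n)) p volume ≤
      eLpNorm g p volume + ENNReal.ofReal (C / ((n : ℝ) + 1)) * eLpNorm u p volume := by
  have hr : (0 : ℝ) < 1 / ((n : ℝ) + 1) := by positivity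
  set ρ : EuclideanSpace ℝ (Fin d) → ℝ := mollifier (1 / ((n : ℝ) + 1)) with hρ
  set χ : EuclideanSpace ℝ (Fin d) → ℝ := fun x => radialBump (((n : ℝ) + 1)⁻¹ • x) with hχ
  set w : EuclideanSpace ℝ (Fin d) → ℝ := fun x => ∫ y, ρ (x - y) • u y with hw
  have hρd := contDiff_mollifier (d := d) (1 / ((n : ℝ) + 1))
  have hρs := hasCompactSupport_mollifier (d := d) hr
  have hρi : Integrable ρ := hρd.continuous.integrable_of_hasCompactSupport hρs
  have hwd : ContDiff ℝ 1 w := contDiff_mollify hug.1 hρd hρs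
  have hχd : ContDiff ℝ 1 χ := (contDiff_radialBump_scaled _).of_le (by exact_mod_cast le_top)
  have hder : fderiv ℝ (smoothApprox u n) =
      (fun x => χ x • fderiv ℝ w x) + fun x => w x • fderiv ℝ χ x := by
    funext x
    exact fderiv_fun_mul (hχd.differentiable one_ne_zero x) (hwd.differentiable one_ne_zero x)
  have hwc := hwd.continuous_fderiv one_ne_zero
  have hχc := hχd.continuous_fderiv one_ne_zero
  rw [hder]
  refine (eLpNorm_add_le (hχd.continuous.smul hwc).aestronglyMeasurable
    (hwd.continuous.smul hχc).aestronglyMeasurable hp).trans (add_le_add ?_ ?_)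
  · refine (eLpNorm_mono fun x => ?_).trans
      (eLpNorm_mollify_le (mollifier_nonneg hr) hρd.continuous hρi (integral_mollifier hr)
        hug.2.1.aestronglyMeasurable hp hp')
    rw [Pi.smul_apply', norm_smul, Real.norm_of_nonneg (radialBump_nonneg _)]
    exact (mul_le_of_le_one_left (norm_nonneg _) (radialBump_le_one _)).trans
      (norm_fderiv_mollify_le hug hρd hρs x)
  · refine (eLpNorm_le_mul_eLpNorm_of_ae_le_mul (g := w) (c := C / ((n : ℝ) + 1))
      (Filter.Eventually.of_forall fun x => ?_) p).trans ?_
    · rw [Pi.smul_apply', norm_smul, mul_comm]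
      exact mul_le_mul_of_nonneg_right (hC _ (by positivity) x) (norm_nonneg _)
    · gcongr
      exact eLpNorm_mollify_le (mollifier_nonneg hr) hρd.continuous hρi (integral_mollifier hr)
        hug.1.aestronglyMeasurable hp hp'

end smoothApprox

/-! ### Passage to the limit -/

lemma eLpNorm_rpow_eq_ofReal_integral {α F : Type*} [MeasurableSpace α] {μ : Measure α}
    [NormedAddCommGroup F] {f : α → F} {p : ℝ} (hp : 0 < p)
    (hf : Integrable (fun x => ‖f x‖ ^ p) μ) :
    eLpNorm f (ENNReal.ofReal p) μ ^ p = ENNReal.ofReal (∫ x, ‖f x‖ ^ p ∂μ) := by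
  rw [eLpNorm_eq_lintegral_rpow_enorm_toReal (by simpa using hp) ENNReal.ofReal_ne_top,
    ENNReal.toReal_ofReal hp.le, ← ENNReal.rpow_mul, one_div_mul_cancel hp.ne',
    ENNReal.rpow_one, ofReal_integral_eq_lintegral_ofReal hf
      (Filter.Eventually.of_forall fun x => by positivity)]
  refine lintegral_congr fun x => ?_
  rw [← ENNReal.ofReal_rpow_of_nonneg (norm_nonneg _) hp.le, ofReal_norm]

/-- The Hardy inequality for truncations, in terms of lower integrals. -/
lemma lintegral_truncation_le {d : ℕ} (hd : 2 ≤ d) {p : ℝ} (hp : 2 ≤ p)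
    {v : EuclideanSpace ℝ (Fin d) → ℝ} (hv : ContDiff ℝ 1 v) (hvs : HasCompactSupport v)
    (hwall : ∀ x, x ∉ offWalls d → v x = 0) {ε : ℝ} (hε : 0 < ε) :
    ∫⁻ x, ENNReal.ofReal (max (|v x| - ε) 0 ^ p / ‖x‖ ^ p) ≤
      (ENNReal.ofReal (hardyConst d p))⁻¹ *
        eLpNorm (fderiv ℝ v) (ENNReal.ofReal p) volume ^ p := by
  obtain ⟨h1, h2, h3⟩ := hardy_truncation hd hp hv hvs hwall hε
  have hp0 : 0 < p := by linarith
  have hC := hardyConst_pos hd hp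
  rw [eLpNorm_rpow_eq_ofReal_integral hp0 h2, ← ofReal_integral_eq_lintegral_ofReal h1
    (Filter.Eventually.of_forall fun x => by positivity), ← ENNReal.ofReal_inv_of_pos hC,
    ← ENNReal.ofReal_mul (by positivity)]
  apply ENNReal.ofReal_le_ofReal
  rwa [le_inv_mul_iff₀ hC]

/-- The Hardy inequality for antisymmetric functions, in terms of lower integrals. -/
theorem lintegral_hardy_le {d : ℕ} (hd : 2 ≤ d) {p : ℝ} (hp : 2 ≤ p)
    {u : EuclideanSpace ℝ (Fin d) → ℝ} (hu : MemLp u (ENNReal.ofReal p) volume)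
    (hanti : IsAntisymmetric u) {g : EuclideanSpace ℝ (Fin d) → EuclideanSpace ℝ (Fin d)}
    (hug : IsWeakGradient u g) :
    ∫⁻ x, ENNReal.ofReal (|u x| ^ p / ‖x‖ ^ p) ≤
      (ENNReal.ofReal (hardyConst d p))⁻¹ * eLpNorm g (ENNReal.ofReal p) volume ^ p := by
  have hp0 : 0 < p := by linarith
  have hp1 : (1 : ENNReal) ≤ ENNReal.ofReal p := by
    rw [← ENNReal.ofReal_one]
    exact ENNReal.ofReal_le_ofReal (by linarith)
  obtain ⟨C, -, hC⟩ := exists_norm_fderiv_radialBump_scaled_le d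
  set v := smoothApprox u with hv
  have hvd := contDiff_smoothApprox hug.1
  set ε : ℕ → ℝ := fun n => 1 / ((n : ℝ) + 1) with hε
  have hε0 : Filter.Tendsto ε Filter.atTop (nhds 0) := tendsto_one_div_add_atTop_nhds_zero_nat
  set B : ℕ → ENNReal := fun n => (ENNReal.ofReal (hardyConst d p))⁻¹ *
    (eLpNorm g (ENNReal.ofReal p) volume + ENNReal.ofReal (C / ((n : ℝ) + 1)) *
      eLpNorm u (ENNReal.ofReal p) volume) ^ p with hB
  have hBlim : Filter.Tendsto B Filter.atTop (nhds ((ENNReal.ofReal (hardyConst d p))⁻¹ *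
      eLpNorm g (ENNReal.ofReal p) volume ^ p)) := by
    have h1 : Filter.Tendsto (fun n : ℕ => C / ((n : ℝ) + 1)) Filter.atTop (nhds 0) := by
      simpa [hε, div_eq_mul_inv] using hε0.const_mul C
    have h2 := ENNReal.Tendsto.mul_const (b := eLpNorm u (ENNReal.ofReal p) volume)
      (ENNReal.tendsto_ofReal h1) (Or.inr hu.2.ne)
    have h3 := ((tendsto_const_nhds (x := eLpNorm g (ENNReal.ofReal p) volume)).add h2).ennrpow_const p
    simp only [ENNReal.ofReal_zero, zero_mul, add_zero] at h3
    refine ENNReal.Tendsto.const_mul h3 (Or.inr ?_)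
    exact ENNReal.inv_ne_top.2 (by simpa using hardyConst_pos hd hp)
  have hle : ∀ n, ∫⁻ x, ENNReal.ofReal (max (|v n x| - ε n) 0 ^ p / ‖x‖ ^ p) ≤ B n := by
    intro n
    refine (lintegral_truncation_le hd hp (hvd n) (hasCompactSupport_smoothApprox n)
      (fun x hx => smoothApprox_eq_zero hanti n hx) (by positivity)).trans ?_
    simp only [hB]
    gcongr
    exact eLpNorm_fderiv_smoothApprox_le hug hp1 ENNReal.ofReal_ne_top hC n
  -- The truncation level tends to zero along with the mollification scale, so one application of
  -- Fatou's lemma suffices.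
  have hlim : ∀ᵐ x, ENNReal.ofReal (|u x| ^ p / ‖x‖ ^ p) =
      Filter.liminf (fun n => ENNReal.ofReal (max (|v n x| - ε n) 0 ^ p / ‖x‖ ^ p))
        Filter.atTop := by
    filter_upwards [ae_tendsto_smoothApprox hug.1] with x hx
    refine (Filter.Tendsto.liminf_eq (ENNReal.tendsto_ofReal (Filter.Tendsto.div_const ?_ _))).symm
    have h := ((hx.abs.sub hε0).max (tendsto_const_nhds (x := (0 : ℝ)))).rpow_const
      (p := p) (Or.inr hp0.le)
    simpa using h
  rw [lintegral_congr_ae hlim]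
  refine (lintegral_liminf_le fun n => ?_).trans ?_
  · have := (hvd n).continuous.measurable
    fun_prop
  · rw [← hBlim.liminf_eq]
    exact Filter.liminf_le_liminf (Filter.Eventually.of_forall hle)

end HardyAntisym

theorem theorem1p2 (d : ℕ) (hd : 2 ≤ d) (p : ℝ) (hp : 2 ≤ p)
    (u : EuclideanSpace ℝ (Fin d) → ℝ) (hu : HardyAntisym.MemW1pA p u)
    (gradu : EuclideanSpace ℝ (Fin d) → EuclideanSpace ℝ (Fin d))
    (hgradu : HardyAntisym.IsWeakGradient u gradu) :
    Integrable (fun x => ‖gradu x‖ ^ p) volume ∧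
    Integrable (fun x => |u x| ^ p / ‖x‖ ^ p) volume ∧
    HardyAntisym.hardyConst d p * ∫ x, |u x| ^ p / ‖x‖ ^ p ≤ ∫ x, ‖gradu x‖ ^ p := by
  obtain ⟨⟨huLp, g, hg, hgLp⟩, hanti⟩ := hu
  have hp0 : 0 < p := by linarith
  -- Only the witness `g` is known to lie in L^p; uniqueness transfers this to the given gradient.
  have hgrad : MemLp gradu (ENNReal.ofReal p) volume := hgLp.ae_eq (hg.ae_eq hgradu)
  have hI : Integrable (fun x => ‖gradu x‖ ^ p) volume := by
    have h := hgrad.integrable_norm_rpow (by simpa using hp0) ENNReal.ofReal_ne_top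
    simpa only [ENNReal.toReal_ofReal hp0.le] using h
  have hC := HardyAntisym.hardyConst_pos hd hp
  have hle := HardyAntisym.lintegral_hardy_le hd hp huLp hanti hgradu
  rw [HardyAntisym.eLpNorm_rpow_eq_ofReal_integral hp0 hI, ← ENNReal.ofReal_inv_of_pos hC, ← ENNReal.ofReal_mul (by positivity)] at hle
  have hmeas : AEStronglyMeasurable (fun x => |u x| ^ p / ‖x‖ ^ p) volume := by
    have := huLp.1.aemeasurable
    exact AEMeasurable.aestronglyMeasurable (by fun_prop)
  have hJ : Integrable (fun x => |u x| ^ p / ‖x‖ ^ p) volume := by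
    refine ⟨hmeas, ?_⟩
    rw [hasFiniteIntegral_iff_ofReal (Filter.Eventually.of_forall fun x => by positivity)]
    exact hle.trans_lt ENNReal.ofReal_lt_top
  refine ⟨hI, hJ, ?_⟩
  rw [← ofReal_integral_eq_lintegral_ofReal hJ
    (Filter.Eventually.of_forall fun x => by positivity)] at hle
  have hnn : 0 ≤ ∫ x, ‖gradu x‖ ^ p := integral_nonneg fun x => by positivity
  rwa [ENNReal.ofReal_le_ofReal_iff (by positivity), le_inv_mul_iff₀ hC] at hle
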